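/- Conventions. Let $\square$ be the category whose objects are the natural numbers and whose morphisms $m\to n$ are the words of length $n$ in the letters $-,0,+$ with exactly $m$ letters $0$; the composite $g\circ f$ is obtained by substituting the letters of $f$ for the successive letters $0$ of $g$. A \emph{relational precubical set} $P$ consists of sets $P(k)$ of $k$-cubes ($k\in\mathbb N$) and, for each $f:k\to l$ in $\square$, a relation $a\to_f b$ between $a\in P(l)$ and $b\in P(k)$, such that $a\to_{\mathrm{id}}a$, and $a\to_f b\to_g c$ implies $a\to_{f\circ g}c$. A morphism is a family of functions $P(k)\to Q(k)$ preserving all relations. For a cube $c$ of $P$, $\uparrow c$ is the relational precubical set with cubes the pairs $(d,f)$ with $d\to_f c$, and relations $(d',g\circ f)\to_g(d,f)$ whenever $d'\to_g d$. The tensor product $P\otimes Q$ has as $n$-cubes the pairs $(p,q)\in P(i)\times Q(j)$ with $i+j=n$, and $(p,q)\to_{uv}(p',q')$ ($uv$ the concatenation of the words $u$ and $v$) whenever $p\to_u p'$ and $q\to_v q'$. Fix $n\in\mathbb N$. Let $V_0$ be the graph with one edge $p_0$ from one vertex to another, and $V_1$ the graph with two consecutive edges and central vertex $p_1$ (a graph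 is a precubical set with $e\to_-\mathrm{source}(e)$ and $e\to_+\mathrm{target}(e)$). For $\epsilon\in\{0,1\}^n$, the \emph{euclidean brick} of codimension $\epsilon_1+\dots+\epsilon_n$ is $B_\epsilon=\uparrow(p_{\epsilon_1},\dots,p_{\epsilon_n})$, taken in $V_{\epsilon_1}\otimes\dots\otimes V_{\epsilon_n}$; its minimal cube is $\min(B_\epsilon)=((p_{\epsilon_1},\dots,p_{\epsilon_n}),\mathrm{id})$. A morphism $\alpha$ is a \emph{local embedding} if $\alpha(a)\neq\alpha(b)$ for all distinct cubes $a,b$ with $a\to_w c$ and $b\to_w c$ for some $w$ and $c$. $P$ is \emph{($n$-)euclidean} if for each cube $c$ of $P$ there are $\epsilon\in\{0,1\}^n$ and a surjective local embedding $B_\epsilon\to\uparrow c$. Let $D_\epsilon$ be the set of words $w\in\{+,-,0,1\}^n$ with $w_i=0$ if and only if $\epsilon_i=0$, and let $p(w)\in\{0,1\}^n$ be obtained from $w$ by replacing $+$ and $-$ by $0$. For $w\in D_\epsilon$, let $\iota_w:B_{p(w)}\to B_\epsilon$ be the inclusion induced by the inclusions $V_0\to V_1$ onto the first edge (where $w_i=-$)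 and onto the second edge (where $w_i=+$), and by identities elsewhere. The \emph{($n$-)blowup} $\tilde P$ has as $k$-cubes the morphisms $f:B_\epsilon\to P$ with $\epsilon$ of codimension $n-k$; its relations are $f\circ\iota_w\to_g f$ for $f:B_\epsilon\to P$ and $w\in D_\epsilon$ with $\iota_w(\min(B_{p(w)}))\to_g\min(B_\epsilon)$ in $B_\epsilon$. It is functorial in $P$ by postcomposition. The \emph{blowup map} $\beta_P:\tilde P\to P$ sends $f:B_\epsilon\to P$ to $f(\min(B_\epsilon))$. Corollary. For every $n\in\mathbb N$, the full subcategory of ($n$-)euclidean relational precubical sets is coreflective in the category of relational precubical sets, and the coreflector is the ($n$-)blowup: $\tilde P$ is euclidean for every relational precubical set $P$, and the functor $P\mapsto\tilde P$ is right adjoint to the inclusion of the full subcategory, with counit $\beta_P:\tilde P\to P$. -/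

import Mathlib

open CategoryTheory

universe w

/-! ### Relational presheaves -/

/-- A relational presheaf over `C` (a lax functor from `Cᵒᵖ` to sets and relations): a set for
every object and, for `f : d ⟶ c`, a relation `rel f a b`, read `a →_f b`, between elements
`a` over `c` and elements `b` over `d`, which is reflexive and transitive. -/
structure RelPsh (C : Type*) [Category* C] where
  obj : C → Type w
  rel : ∀ {d c : C}, (d ⟶ c) → obj c → obj d → Prop
  refl : ∀ {c : C} (x : obj c), rel (𝟙 c) x x
  trans : ∀ {e d c : C} {g : e ⟶ d} {f : d ⟶ c} {x : obj c} {y : obj d} {z : obj e},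
    rel f x y → rel g y z → rel (g ≫ f) x z

namespace RelPsh

universe v u w₁ w₂ w₃

variable {C : Type u} [Category.{v} C]

/-- A morphism of relational presheaves: a family of functions preserving the relations. The two
presheaves may take values in different universes. -/
@[ext]
structure Hom (P : RelPsh.{w₁} C) (Q : RelPsh.{w₂} C) where
  app : ∀ c : C, P.obj c → Q.obj c
  map_rel : ∀ {d c : C} {f : d ⟶ c} {x : P.obj c} {y : P.obj d},
    P.rel f x y → Q.rel f (app c x) (app d y)

/-- The identity morphism. -/
def Hom.id (P : RelPsh.{w₁} C) : Hom P P where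
  app _ x := x
  map_rel h := h

/-- Composition of morphisms, in diagrammatic order. -/
def Hom.comp {P : RelPsh.{w₁} C} {Q : RelPsh.{w₂} C} {R : RelPsh.{w₃} C}
    (α : Hom P Q) (β : Hom Q R) : Hom P R where
  app c x := β.app c (α.app c x)
  map_rel h := β.map_rel (α.map_rel h)

instance : Category (RelPsh.{w} C) where
  Hom P Q := Hom P Q
  id P := Hom.id P
  comp α β := Hom.comp α β

/-- The upward neighborhood `↑x`: its elements are the pairs `(y, f)` with `y →_f x`, and
`(z, g ∘ f) →_g (y, f)` whenever `z →_g y`. -/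
def up (P : RelPsh.{w} C) {c : C} (x : P.obj c) : RelPsh.{max w v} C where
  obj d := {p : P.obj d × (c ⟶ d) // P.rel p.2 p.1 x}
  rel g a b := P.rel g a.1.1 b.1.1 ∧ a.1.2 = b.1.2 ≫ g
  refl x := ⟨P.refl _, by simp⟩
  trans h h' := ⟨P.trans h.1 h'.1, by rw [h.2, h'.2, Category.assoc]⟩

/-- If `α(x) →_g y`, then `α` induces a morphism `↑x ⟶ ↑y`, `(z, h) ↦ (α(z), h ∘ g)`. -/
def upMap {P : RelPsh.{w₁} C} {Q : RelPsh.{w₂} C} (α : Hom P Q) {c d : C} {x : P.obj c}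
    {y : Q.obj d} (g : d ⟶ c) (hg : Q.rel g (α.app c x) y) : Hom (P.up x) (Q.up y) where
  app e a := ⟨(α.app e a.1.1, g ≫ a.1.2), Q.trans (α.map_rel a.2) hg⟩
  map_rel h := ⟨α.map_rel h.1, by dsimp only; rw [h.2, Category.assoc]⟩

/-- Local embeddings: distinct `a`, `b` with `a →_f c` and `b →_f c` for some common `f` and `c`
have distinct images. -/
def Hom.IsLocalEmbedding {P : RelPsh.{w₁} C} {Q : RelPsh.{w₂} C} (α : Hom P Q) : Prop :=
  ∀ {k m : C} (f : m ⟶ k) (a b : P.obj k) (c : P.obj m),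
    P.rel f a c → P.rel f b c → a ≠ b → α.app k a ≠ α.app k b

/-- Surjectivity on elements. -/
def Hom.IsSurjective {P : RelPsh.{w₁} C} {Q : RelPsh.{w₂} C} (α : Hom P Q) : Prop :=
  ∀ c : C, Function.Surjective (α.app c)

end RelPsh

/-! ### The category `□` -/

/-- The category `□`, whose objects are the natural numbers. -/
@[ext]
structure Box where
  dim : ℕ

namespace Box

/-- `subst f g` replaces the successive letters `0` of the word `g` by the letters of `f`. -/
def subst : List SignType → List SignType → List SignType
  | _, [] => []
  | a :: f, .zero :: g => a :: subst f g
  | [], .zero :: g => .zero :: subst [] g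
  | f, .neg :: g => .neg :: subst f g
  | f, .pos :: g => .pos :: subst f g

/-- A morphism `m ⟶ n` of `□`, in normal form: a word of length `n` in the letters
`-`, `0`, `+` with exactly `m` letters `0`. The word with letters `η₁, …, ηₖ` in the positions
`i₁ < … < iₖ` and `0` elsewhere stands for `d^{ηₖ}_{iₖ} ∘ … ∘ d^{η₁}_{i₁}`. -/
@[ext]
structure Face (m n : Box) where
  word : List SignType
  length_eq : word.length = n.dim
  count_eq : word.count 0 = m.dim

theorem length_subst (f g : List SignType) : (subst f g).length = g.length := by
  fun_induction subst f g <;> simp_all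

theorem count_subst (f g : List SignType) (h : f.length = g.count 0) :
    (subst f g).count 0 = f.count 0 := by
  fun_induction subst f g <;> simp_all [List.count_cons, SignType.zero_eq_zero]

theorem subst_zeros_left (g : List SignType) :
    subst (List.replicate (g.count 0) 0) g = g := by
  induction g with
  | nil => rfl
  | cons a g ih =>
    cases a
    · have : List.count 0 (SignType.zero :: g) = g.count 0 + 1 := List.count_cons_self
      rw [this, List.replicate_succ]
      exact congrArg _ ih
    · have : List.count 0 (SignType.neg :: g) = g.count 0 :=
        List.count_cons_of_ne (by decide)
      rw [this]
      exact (by rw [subst, ih])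
    · have : List.count 0 (SignType.pos :: g) = g.count 0 :=
        List.count_cons_of_ne (by decide)
      rw [this]
      exact (by rw [subst, ih])

theorem subst_zeros_right (f : List SignType) :
    subst f (List.replicate f.length 0) = f := by
  induction f with
  | nil => rfl
  | cons a f ih => exact congrArg _ ih

theorem subst_assoc (f g h : List SignType) (hg : g.length = h.count 0) :
    subst (subst f g) h = subst f (subst g h) := by
  induction h generalizing f g with
  | nil => simp [subst]
  | cons c h ih =>
    cases c
    · have : List.count 0 (SignType.zero :: h) = h.count 0 + 1 := List.count_cons_self
      rw [this] at hg
      obtain _ | ⟨b, g⟩ := g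
      · simp at hg
      · have hg' : g.length = h.count 0 := by simpa using hg
        cases b
        · obtain _ | ⟨a, f⟩ := f <;> simp [subst, ih _ _ hg']
        · simp [subst, ih _ _ hg']
        · simp [subst, ih _ _ hg']
    · have : List.count 0 (SignType.neg :: h) = h.count 0 :=
        List.count_cons_of_ne (by decide)
      rw [this] at hg
      simp [subst, ih _ _ hg]
    · have : List.count 0 (SignType.pos :: h) = h.count 0 :=
        List.count_cons_of_ne (by decide)
      rw [this] at hg
      simp [subst, ih _ _ hg]

instance : Category Box where
  Hom m n := Face m n
  id n := ⟨List.replicate n.dim 0, by simp, by simp⟩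
  comp f g := ⟨subst f.word g.word, by rw [length_subst, g.length_eq],
    by rw [count_subst _ _ (f.length_eq.trans g.count_eq.symm), f.count_eq]⟩
  id_comp := by
    intro m n g
    apply Face.ext
    change subst (List.replicate m.dim 0) g.word = g.word
    rw [← g.count_eq, subst_zeros_left]
  comp_id := by
    intro m n g
    apply Face.ext
    change subst g.word (List.replicate n.dim 0) = g.word
    rw [← g.length_eq, subst_zeros_right]
  assoc f g h := Face.ext (subst_assoc _ _ _ (g.length_eq.trans h.count_eq.symm))

/-- The word of a morphism of `□`. -/
def word {m n : Box} (f : m ⟶ n) : List SignType := Face.word f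

theorem length_word {m n : Box} (f : m ⟶ n) : (word f).length = n.dim := Face.length_eq f

theorem count_word {m n : Box} (f : m ⟶ n) : (word f).count 0 = m.dim := Face.count_eq f

theorem word_id (n : Box) : word (𝟙 n) = List.replicate n.dim 0 := rfl

theorem word_comp {l m n : Box} (f : l ⟶ m) (g : m ⟶ n) :
    word (f ≫ g) = subst (word f) (word g) := rfl

theorem hom_ext {m n : Box} {f g : m ⟶ n} (h : word f = word g) : f = g := Face.ext h

theorem subst_append (f f' g g' : List SignType) (h : f.length = g.count 0) :
    subst (f ++ f') (g ++ g') = subst f g ++ subst f' g' := by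
  induction g generalizing f with
  | nil =>
    obtain rfl : f = [] := by simpa using h
    simp [subst]
  | cons b g ih =>
    cases b
    · have : List.count 0 (SignType.zero :: g) = g.count 0 + 1 := List.count_cons_self
      rw [this] at h
      obtain _ | ⟨a, f⟩ := f
      · simp at h
      · have hg' : f.length = g.count 0 := by simpa using h
        simp [subst, ih _ hg']
    · have : List.count 0 (SignType.neg :: g) = g.count 0 :=
        List.count_cons_of_ne (by decide)
      rw [this] at h
      simp [subst, ih _ h]
    · have : List.count 0 (SignType.pos :: g) = g.count 0 :=
        List.count_cons_of_ne (by decide)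
      rw [this] at h
      simp [subst, ih _ h]

end Box

/-! ### Relational precubical sets -/

/-- The category of relational precubical sets. -/
abbrev RelPrecubicalSet := RelPsh.{w} Box

namespace RelPrecubicalSet

open RelPsh

/-- The cubes of a graph with vertices `V` and edges `E`. -/
inductive GraphCube (V E : Type) : Box → Type
  | vertex (v : V) : GraphCube V E ⟨0⟩
  | edge (e : E) : GraphCube V E ⟨1⟩

/-- The face relation of a graph with source map `s` and target map `t`, for a face given by its
word: besides the identities, `e →_- s(e)` and `e →_+ t(e)` for every edge `e`. -/
def graphRel {V E : Type} (s t : E → V) (l : List SignType) :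
    ∀ {n m : Box}, GraphCube V E n → GraphCube V E m → Prop
  | _, _, .vertex v, .vertex v' => v = v'
  | _, _, .edge e, .edge e' => e = e'
  | _, _, .edge e, .vertex v => (l = [-1] ∧ s e = v) ∨ (l = [1] ∧ t e = v)
  | _, _, .vertex _, .edge _ => False

/-- A directed graph seen as a (relational) precubical set of dimension at most one. -/
def ofGraph {V E : Type} (s t : E → V) : RelPrecubicalSet.{0} where
  obj n := GraphCube V E n
  rel f x y := graphRel s t (Box.word f) x y
  refl x := by cases x <;> rfl
  trans {k m n g f x y z} h h' := by
    cases x <;> cases y <;> cases z <;> simp only [graphRel] at h h' ⊢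
    · exact h.trans h'
    · have hg : g = 𝟙 (⟨0⟩ : Box) := by
        apply Box.hom_ext
        have := Box.length_word g
        rw [List.length_eq_zero_iff.1 this]
        rfl
      subst h' hg
      rwa [Category.id_comp]
    · have hf : f = 𝟙 (⟨1⟩ : Box) := by
        apply Box.hom_ext
        have h1 := Box.length_word f
        have h2 := Box.count_word f
        obtain ⟨a, ha⟩ := List.length_eq_one_iff.1 h1
        rw [ha] at h2 ⊢
        change [a] = [0]
        clear ha
        revert h2
        revert a
        decide
      subst h hf
      rwa [Category.comp_id]
    · exact h.trans h'

/-- A pair of cubes `(p, q)` of `P` and `Q` whose dimensions add up to `n`. -/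
structure TensorCube (P Q : RelPrecubicalSet.{w}) (n : Box) where
  i : Box
  j : Box
  left : P.obj i
  right : Q.obj j
  add_eq : i.dim + j.dim = n.dim

/-- The tensor product: `(p, q) →_f (p', q')` when `f` is the concatenation of two words `u` and
`v` with `p →_u p'` and `q →_v q'`. -/
def tensor (P Q : RelPrecubicalSet.{w}) : RelPrecubicalSet.{w} where
  obj n := TensorCube P Q n
  rel f x y := ∃ (u : y.i ⟶ x.i) (v : y.j ⟶ x.j),
    Box.word f = Box.word u ++ Box.word v ∧ P.rel u x.left y.left ∧ Q.rel v x.right y.right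
  refl := by
    rintro n ⟨i, j, p, q, h⟩
    refine ⟨𝟙 _, 𝟙 _, ?_, P.refl p, Q.refl q⟩
    rw [Box.word_id, ← h]
    exact List.replicate_add ..
  trans := by
    rintro k m n g f x y z ⟨u, v, hf, hu, hv⟩ ⟨u', v', hg, hu', hv'⟩
    refine ⟨u' ≫ u, v' ≫ v, ?_, P.trans hu hu', Q.trans hv hv'⟩
    rw [Box.word_comp, hf, hg, Box.word_comp, Box.word_comp, Box.subst_append]
    rw [Box.length_word, Box.count_word]

/-- Functoriality of the tensor product. -/
def tensorMap {P P' Q Q' : RelPrecubicalSet.{w}} (α : Hom P P') (β : Hom Q Q') :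
    Hom (tensor P Q) (tensor P' Q') where
  app _ x := ⟨x.i, x.j, α.app _ x.left, β.app _ x.right, x.add_eq⟩
  map_rel := by
    rintro _ _ _ _ _ ⟨u, v, h, hu, hv⟩
    exact ⟨u, v, h, α.map_rel hu, β.map_rel hv⟩

/-! ### Euclidean bricks

The digits `0` and `1` of `ε ∈ {0,1}ⁿ` are written `false` and `true`. -/

/-- `V₀` is the graph with one edge, `V₁` the graph with two consecutive edges: the edge `i` goes
from the vertex `i` to the vertex `i + 1`. -/
def V (b : Bool) : RelPrecubicalSet.{0} :=
  ofGraph (V := Fin (b.toNat + 2)) (E := Fin (b.toNat + 1)) Fin.castSucc Fin.succ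

/-- The dimension of the cube `p_b` of `V_b`. -/
def cellDim : Bool → Box
  | false => ⟨1⟩
  | true => ⟨0⟩

/-- `p₀` is the edge of `V₀`, and `p₁` is the central vertex of `V₁`. -/
def cell : ∀ b : Bool, (V b).obj (cellDim b)
  | false => GraphCube.edge (0 : Fin 1)
  | true => GraphCube.vertex (1 : Fin 3)

/-- The closed euclidean brick `V_{ε₁} ⊗ … ⊗ V_{εₙ}`; for `n = 0` it is a point. -/
def closedBrick : ∀ {n : ℕ}, (Fin n → Bool) → RelPrecubicalSet.{0}
  | 0, _ => ofGraph (V := Unit) (E := Empty) Empty.elim Empty.elim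
  | _ + 1, ε => tensor (V (ε 0)) (closedBrick (Fin.tail ε))

/-- The dimension of `c(ε)`, that is, the number of digits `0` of `ε`. -/
def brickDim : ∀ {n : ℕ}, (Fin n → Bool) → Box
  | 0, _ => ⟨0⟩
  | _ + 1, ε => ⟨(cellDim (ε 0)).dim + (brickDim (Fin.tail ε)).dim⟩

/-- The cube `c(ε) = (p_{ε₁}, …, p_{εₙ})` of the closed brick. -/
def center : ∀ {n : ℕ} (ε : Fin n → Bool), (closedBrick ε).obj (brickDim ε)
  | 0, _ => GraphCube.vertex ()
  | _ + 1, ε => ⟨_, _, cell (ε 0), center (Fin.tail ε), rfl⟩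

/-- The euclidean brick `B_ε = ↑c(ε)`. -/
def brick {n : ℕ} (ε : Fin n → Bool) : RelPrecubicalSet.{0} := (closedBrick ε).up (center ε)

/-- The minimal cube of `B_ε`. -/
def minCube {n : ℕ} (ε : Fin n → Bool) : (brick ε).obj (brickDim ε) :=
  ⟨(center ε, 𝟙 (brickDim ε)), (closedBrick ε).refl (center ε)⟩

/-! ### Euclidean relational precubical sets -/

/-- `P` is `n`-euclidean if every cube `c` has a chart, i.e. a surjective local embedding of a
euclidean brick onto `↑c`. -/
def isEuclidean (n : ℕ) : ObjectProperty RelPrecubicalSet.{w} := fun P =>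
  ∀ (k : Box) (c : P.obj k), ∃ (ε : Fin n → Bool) (φ : Hom (brick ε) (P.up c)),
    φ.IsSurjective ∧ φ.IsLocalEmbedding

/-! ### The inclusions of euclidean bricks -/

/-- `Letter a b` is the set of letters `x ∈ {+,-,0,1}` with `p(x) = a` which may stand in a
position where `ε` has the digit `b` in a word of `D_ε`: the letter `0` if `b = 0`, and `1`, `-`
or `+` if `b = 1`; the projection `p` maps `0`, `-`, `+` to `0` and `1` to `1`. -/
inductive Letter : Bool → Bool → Type
  | zero : Letter false false
  | one : Letter true true
  | minus : Letter false true
  | plus : Letter false true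

/-- The two inclusions `V₀ ⟶ V₁`, onto the first edge for `-` and onto the second edge for `+`,
and the identities of `V₀` and `V₁`. -/
def Letter.hom : ∀ {a b : Bool}, Letter a b → Hom (V a) (V b)
  | _, _, .zero => Hom.id _
  | _, _, .one => Hom.id _
  | _, _, .minus =>
    { app := fun n x => match n, x with
        | _, .vertex v => GraphCube.vertex (Fin.castSucc v)
        | _, .edge e => GraphCube.edge (Fin.castSucc e)
      map_rel := by
        rintro m n f (x | x) (y | y) h
        · exact congrArg Fin.castSucc h
        · exact h
        · obtain ⟨h, rfl⟩ | ⟨h, rfl⟩ := h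
          exacts [Or.inl ⟨h, rfl⟩, Or.inr ⟨h, rfl⟩]
        · exact congrArg Fin.castSucc h }
  | _, _, .plus =>
    { app := fun n x => match n, x with
        | _, .vertex v => GraphCube.vertex (Fin.succ v)
        | _, .edge e => GraphCube.edge (Fin.succ e)
      map_rel := by
        rintro m n f (x | x) (y | y) h
        · exact congrArg Fin.succ h
        · exact h
        · obtain ⟨h, rfl⟩ | ⟨h, rfl⟩ := h
          exacts [Or.inl ⟨h, rfl⟩, Or.inr ⟨h, rfl⟩]
        · exact congrArg Fin.succ h }

/-- The contribution of a letter to the word of `g_w`: letters `1` are removed, signs are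
exchanged (the centre of `V₁` is the front face of its first edge). -/
def Letter.sign : ∀ {a b : Bool}, Letter a b → List SignType
  | _, _, .zero => [0]
  | _, _, .one => []
  | _, _, .minus => [1]
  | _, _, .plus => [-1]

/-- The words `w ∈ D_ε` with `p(w) = ε'`. The poset `D_ε` is the disjoint union of these sets over
all `ε'`. -/
def BrickWord {n : ℕ} (ε' ε : Fin n → Bool) : Type := ∀ i, Letter (ε' i) (ε i)

/-- The tail of a word. -/
def BrickWord.tail {n : ℕ} {ε' ε : Fin (n + 1) → Bool} (x : BrickWord ε' ε) :
    BrickWord (Fin.tail ε') (Fin.tail ε) := fun i => x i.succ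

/-- The inclusion of closed bricks induced by the inclusions `V₀ ⟶ V₁`. -/
def closedIncl : ∀ {n : ℕ} {ε' ε : Fin n → Bool}, BrickWord ε' ε →
    Hom (closedBrick ε') (closedBrick ε)
  | 0, _, _, _ => Hom.id _
  | _ + 1, _, _, x => tensorMap (x 0).hom (closedIncl x.tail)

/-- The word of the morphism `g_w`. -/
def signWord : ∀ {n : ℕ} {ε' ε : Fin n → Bool}, BrickWord ε' ε → List SignType
  | 0, _, _, _ => []
  | _ + 1, _, _, x => (x 0).sign ++ signWord x.tail

theorem Letter.length_sign {a b : Bool} (x : Letter a b) : x.sign.length = (cellDim a).dim := by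
  cases x <;> rfl

theorem Letter.count_sign {a b : Bool} (x : Letter a b) : x.sign.count 0 = (cellDim b).dim := by
  cases x <;> rfl

theorem length_signWord : ∀ {n : ℕ} {ε' ε : Fin n → Bool} (x : BrickWord ε' ε),
    (signWord x).length = (brickDim ε').dim
  | 0, _, _, _ => rfl
  | _ + 1, _, _, x => by
    rw [signWord, List.length_append, Letter.length_sign, length_signWord, brickDim]

theorem count_signWord : ∀ {n : ℕ} {ε' ε : Fin n → Bool} (x : BrickWord ε' ε),
    (signWord x).count 0 = (brickDim ε).dim
  | 0, _, _, _ => rfl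
  | _ + 1, _, _, x => by
    rw [signWord, List.count_append, Letter.count_sign, count_signWord, brickDim]

/-- A letter as a morphism of `□`. -/
def Letter.face {a b : Bool} (x : Letter a b) : cellDim b ⟶ cellDim a :=
  Box.Face.mk x.sign x.length_sign x.count_sign

/-- The morphism `g_w` of `□`. -/
def faceOf {n : ℕ} {ε' ε : Fin n → Bool} (x : BrickWord ε' ε) :
    brickDim ε ⟶ brickDim ε' :=
  Box.Face.mk (signWord x) (length_signWord x) (count_signWord x)

theorem Letter.rel_hom : ∀ {a b : Bool} (x : Letter a b),
    (V b).rel x.face (x.hom.app _ (cell a)) (cell b)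
  | _, _, .zero => rfl
  | _, _, .one => rfl
  | _, _, .minus => Or.inr ⟨rfl, rfl⟩
  | _, _, .plus => Or.inl ⟨rfl, rfl⟩

theorem rel_closedIncl : ∀ {n : ℕ} {ε' ε : Fin n → Bool} (x : BrickWord ε' ε),
    (closedBrick ε).rel (faceOf x) ((closedIncl x).app _ (center ε')) (center ε)
  | 0, _, _, _ => rfl
  | _ + 1, _, _, x => ⟨(x 0).face, faceOf x.tail, rfl, (x 0).rel_hom, rel_closedIncl x.tail⟩

/-- The inclusion `ι_w : B_{p(w)} ⟶ B_ε`. -/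
def incl {n : ℕ} {ε' ε : Fin n → Bool} (x : BrickWord ε' ε) : Hom (brick ε') (brick ε) :=
  upMap (closedIncl x) (faceOf x) (rel_closedIncl x)

/-- The identity word `ε ∈ D_ε`. -/
def BrickWord.id {n : ℕ} (ε : Fin n → Bool) : BrickWord ε ε := fun i =>
  match ε i with
  | false => Letter.zero
  | true => Letter.one

/-- Composition of letters. -/
def Letter.comp : ∀ {a b c : Bool}, Letter a b → Letter b c → Letter a c
  | _, _, _, x, .zero => x
  | _, _, _, x, .one => x
  | _, _, _, .zero, .minus => .minus
  | _, _, _, .zero, .plus => .plus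

/-- Composition of words. -/
def BrickWord.comp {n : ℕ} {ε'' ε' ε : Fin n → Bool} (x : BrickWord ε'' ε')
    (y : BrickWord ε' ε) : BrickWord ε'' ε := fun i => (x i).comp (y i)

theorem closedIncl_id : ∀ {n : ℕ} (ε : Fin n → Bool),
    closedIncl (BrickWord.id ε) = Hom.id (closedBrick ε)
  | 0, _ => rfl
  | n + 1, ε => by
    have h0 : (BrickWord.id ε 0).hom = Hom.id (V (ε 0)) := by
      unfold BrickWord.id
      generalize ε 0 = b
      cases b <;> rfl
    have h1 : (BrickWord.id ε).tail = BrickWord.id (Fin.tail ε) := rfl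
    rw [closedIncl, h0, h1, closedIncl_id]
    rfl

theorem faceOf_id {n : ℕ} (ε : Fin n → Bool) :
    faceOf (BrickWord.id ε) = 𝟙 (brickDim ε) := by
  apply Box.hom_ext
  rw [Box.word_id]
  change signWord _ = _
  induction n with
  | zero => rfl
  | succ n ih =>
    have h0 : (BrickWord.id ε 0).sign = List.replicate (cellDim (ε 0)).dim 0 := by
      unfold BrickWord.id
      generalize ε 0 = b
      cases b <;> rfl
    have h1 : (BrickWord.id ε).tail = BrickWord.id (Fin.tail ε) := rfl
    rw [signWord, h0, h1, ih, brickDim, List.replicate_add]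

theorem Letter.hom_comp : ∀ {a b c : Bool} (x : Letter a b) (y : Letter b c),
    (x.comp y).hom = Hom.comp x.hom y.hom
  | _, _, _, .zero, .zero => rfl
  | _, _, _, .one, .one => rfl
  | _, _, _, .minus, .one => rfl
  | _, _, _, .plus, .one => rfl
  | _, _, _, .zero, .minus => rfl
  | _, _, _, .zero, .plus => rfl

theorem Letter.sign_comp : ∀ {a b c : Bool} (x : Letter a b) (y : Letter b c),
    (x.comp y).sign = Box.subst y.sign x.sign
  | _, _, _, .zero, .zero => rfl
  | _, _, _, .one, .one => rfl
  | _, _, _, .minus, .one => rfl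
  | _, _, _, .plus, .one => rfl
  | _, _, _, .zero, .minus => rfl
  | _, _, _, .zero, .plus => rfl

theorem closedIncl_comp : ∀ {n : ℕ} {ε'' ε' ε : Fin n → Bool} (x : BrickWord ε'' ε')
    (y : BrickWord ε' ε), closedIncl (x.comp y) = Hom.comp (closedIncl x) (closedIncl y)
  | 0, _, _, _, _, _ => rfl
  | n + 1, _, _, _, x, y => by
    have h0 : x.comp y 0 = (x 0).comp (y 0) := rfl
    have h1 : (x.comp y).tail = x.tail.comp y.tail := rfl
    rw [closedIncl, h0, h1, closedIncl_comp, Letter.hom_comp]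
    rfl

theorem signWord_comp : ∀ {n : ℕ} {ε'' ε' ε : Fin n → Bool} (x : BrickWord ε'' ε')
    (y : BrickWord ε' ε), signWord (x.comp y) = Box.subst (signWord y) (signWord x)
  | 0, _, _, _, _, _ => rfl
  | n + 1, _, _, _, x, y => by
    have h0 : x.comp y 0 = (x 0).comp (y 0) := rfl
    have h1 : (x.comp y).tail = x.tail.comp y.tail := rfl
    rw [signWord, h0, h1, signWord_comp, Letter.sign_comp, signWord, signWord, Box.subst_append]
    rw [Letter.length_sign, Letter.count_sign]

theorem incl_id {n : ℕ} (ε : Fin n → Bool) : incl (BrickWord.id ε) = Hom.id (brick ε) := by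
  apply Hom.ext
  funext k a
  apply Subtype.ext
  apply Prod.ext
  · exact congrArg (fun α => Hom.app α k a.1.1) (closedIncl_id ε)
  · change faceOf (BrickWord.id ε) ≫ a.1.2 = a.1.2
    rw [faceOf_id]
    exact Category.id_comp _

theorem incl_comp {n : ℕ} {ε'' ε' ε : Fin n → Bool} (x : BrickWord ε'' ε')
    (y : BrickWord ε' ε) : incl (x.comp y) = Hom.comp (incl x) (incl y) := by
  apply Hom.ext
  funext k a
  apply Subtype.ext
  apply Prod.ext
  · exact congrArg (fun α => Hom.app α k a.1.1) (closedIncl_comp x y)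
  · change faceOf (x.comp y) ≫ a.1.2 = faceOf y ≫ faceOf x ≫ a.1.2
    rw [← Category.assoc]
    congr 1
    exact Box.hom_ext (signWord_comp x y)

/-! ### The blowup -/

/-- A `k`-cube of the `n`-blowup of `P`: a morphism `f : B_ε ⟶ P`, where `ε ∈ {0,1}ⁿ` is such that
the minimal cube of `B_ε` has dimension `k`, i.e. where `B_ε` has codimension `n - k`. -/
structure BlowupCube (n : ℕ) (P : RelPrecubicalSet.{w}) (k : Box) where
  type : Fin n → Bool
  hom : Hom (brick type) P
  dim_eq : brickDim type = k

/-- The `n`-blowup of `P`: `f ∘ ι_w →_g f` for all `f : B_ε ⟶ P` and all `w ∈ D_ε` with `w →_g ε`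
in `B_ε`. Here `w` stands for the cube `ι_w(min B_{p(w)})` and `ε` for the minimal cube of `B_ε`;
`g'` is `g`, seen as a morphism between the dimensions of these two cubes. -/
def blowupObj (n : ℕ) (P : RelPrecubicalSet.{w}) : RelPrecubicalSet.{w} where
  obj k := BlowupCube n P k
  rel g a b := ∃ (x : BrickWord a.type b.type)
    (g' : brickDim b.type ⟶ brickDim a.type),
    Box.word g' = Box.word g ∧
    (brick b.type).rel g' ((incl x).app _ (minCube a.type)) (minCube b.type) ∧
    a.hom = Hom.comp (incl x) b.hom
  refl := by
    rintro _ ⟨ε, f, rfl⟩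
    refine ⟨BrickWord.id ε, 𝟙 _, rfl, ?_, ?_⟩
    · dsimp only
      rw [incl_id]
      exact (brick ε).refl _
    · dsimp only
      rw [incl_id]
      rfl
  trans := by
    intro _ _ _ g f a b c h h'
    obtain ⟨x, f', hf, hx, hab⟩ := h
    obtain ⟨y, g', hg, hy, hbc⟩ := h'
    refine ⟨x.comp y, g' ≫ f', ?_, ?_, ?_⟩
    · rw [Box.word_comp, hg, hf]
      rfl
    · rw [incl_comp]
      exact (brick _).trans ((incl y).map_rel hx) hy
    · rw [incl_comp, hab, hbc]
      rfl

/-- The `n`-blowup as an endofunctor, acting on morphisms by postcomposition. -/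
def blowup (n : ℕ) : RelPrecubicalSet.{w} ⥤ RelPrecubicalSet.{w} where
  obj P := blowupObj n P
  map {P Q} α :=
    { app := fun _ a => ⟨a.type, Hom.comp a.hom α, a.dim_eq⟩
      map_rel := by
        rintro _ _ _ _ _ ⟨x, g', h, hx, hab⟩
        refine ⟨x, g', h, hx, ?_⟩
        dsimp only
        rw [hab]
        rfl }
  map_id _ := rfl
  map_comp _ _ := rfl

/-- The blowup map, `f ↦ f(min(dom f))`. -/
def blowupMap (n : ℕ) (P : RelPrecubicalSet.{w}) : (blowup n).obj P ⟶ P where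
  app _ a := a.dim_eq ▸ a.hom.app (brickDim a.type) (minCube a.type)
  map_rel := by
    intro l k g a b h
    obtain ⟨ε', a, ha⟩ := a
    obtain ⟨ε, b, hb⟩ := b
    obtain ⟨x, g', hg, hx, hab⟩ := h
    subst ha hb
    obtain rfl := Box.hom_ext hg
    change P.rel g' (a.app _ (minCube ε')) (b.app _ (minCube ε))
    have hab' : a = Hom.comp (incl x) b := hab
    rw [hab']
    exact b.map_rel hx

end RelPrecubicalSet

universe w'

namespace RelPrecubicalSet

open RelPsh

/-! ### The cubes of a euclidean brick -/

/-! The cubes of `B_ε` are exactly the `ι_x(min B_{p(x)})` with `x ∈ D_ε`, and `x` can be recovered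
from the cube (`exists_wordCube`, `wordCube_injective`). Sending this cube to `ι_x` is therefore a
morphism from `B_ε` to its own blowup (`brickUnit`). Postcomposed with `f : B_ε ⟶ P`, it gives a
chart of the blowup at `f`: it is onto because the cubes with `f` as a face are the restrictions `f
∘ ι_x`, and injective because `p(x)` and the sign word of `x` determine `x`.

If `P` is euclidean, the blowup map is an isomorphism. A chart of `↑c`, composed with the projection
to `P`, is a cube of the blowup with value `c` along which the relations of `P` into `c` lift
(`isEuclidean.exists_liftsRel`). Such a cube is the only one with value `c`. Its type is read off
from the sign word of any top-dimensional restriction of a competitor: that word has length `n`, and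
its letters `0` stand exactly where `ε` has the digit `0` (`BlowupCube.LiftsRel.type_eq`). Then the
two morphisms are compared one word at a time (`isEuclidean.value_injective`). Lifting also shows
that the inverse preserves relations.

This inverse is the unit of the adjunction. One triangle identity says that it is a section of the
blowup map; the other is checked on an explicit cube of the double blowup (`exists_value_eq_self`).
-/

theorem dim_le_of_hom {m n : Box} (f : m ⟶ n) : m.dim ≤ n.dim := by
  rw [← Box.count_word f, ← Box.length_word f]
  exact List.count_le_length

theorem word_faceOf {n : ℕ} {ε' ε : Fin n → Bool} (x : BrickWord ε' ε) :
    Box.word (faceOf x) = signWord x := rfl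

theorem Letter.eq_of_sign_eq : ∀ {a b : Bool} (x y : Letter a b), x.sign = y.sign → x = y
  | _, _, .zero, .zero, _ => rfl
  | _, _, .one, .one, _ => rfl
  | _, _, .minus, .minus, _ => rfl
  | _, _, .plus, .plus, _ => rfl
  | _, _, .minus, .plus, h => absurd h (by decide)
  | _, _, .plus, .minus, h => absurd h (by decide)

/-- The two types must agree beforehand: the letter `1` leaves no trace in the sign word, so `1-`
and `-1` have the same one. With `ε'` fixed, the position of each sign is known. -/
theorem BrickWord.eq_of_signWord_eq : ∀ {n : ℕ} {ε' ε : Fin n → Bool} (x y : BrickWord ε' ε),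
    signWord x = signWord y → x = y
  | 0, _, _, _, _, _ => funext fun i => i.elim0
  | _ + 1, _, _, x, y, h => by
    obtain ⟨h0, h1⟩ := List.append_inj h (by rw [Letter.length_sign, Letter.length_sign])
    funext i
    refine Fin.cases (Letter.eq_of_sign_eq _ _ h0) (fun j => ?_) i
    exact congrFun (BrickWord.eq_of_signWord_eq x.tail y.tail h1) j

/-- A word of `D_ε` of top dimension determines `ε`. -/
theorem type_eq_of_signWord_eq : ∀ {n : ℕ} {ε ε' : Fin n → Bool}
    (x : BrickWord (fun _ => false) ε) (y : BrickWord (fun _ => false) ε'),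
    signWord x = signWord y → ε = ε'
  | 0, _, _, _, _, _ => funext fun i => i.elim0
  | _ + 1, ε, ε', x, y, h => by
    obtain ⟨h0, h1⟩ := List.append_inj h (by rw [Letter.length_sign, Letter.length_sign])
    funext i
    refine Fin.cases ?_ (fun j => congrFun (type_eq_of_signWord_eq x.tail y.tail h1) j) i
    revert h0
    generalize x 0 = u, y 0 = v
    generalize ε 0 = b, ε' 0 = b' at u v
    cases u <;> cases v <;> simp [Letter.sign]

/-- A word of `D_ε` of top dimension. -/
def topWord {n : ℕ} (ε : Fin n → Bool) : BrickWord (fun _ => false) ε := fun i =>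
  match ε i with
  | false => Letter.zero
  | true => Letter.minus

theorem dim_brickDim_false (n : ℕ) : (brickDim fun _ : Fin n => false).dim = n := by
  induction n with
  | zero => rfl
  | succ n ih =>
    change 1 + (brickDim fun _ : Fin n => false).dim = n + 1
    omega

/-- A word of `D_ε` of the same dimension as `ε` is `ε` itself. -/
theorem type_eq_of_dim_eq : ∀ {n : ℕ} {ε' ε : Fin n → Bool}, BrickWord ε' ε →
    (brickDim ε').dim = (brickDim ε).dim → ε' = ε
  | 0, _, _, _, _ => funext fun i => i.elim0
  | _ + 1, ε', ε, x, h => by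
    have h0 := dim_le_of_hom (x 0).face
    have h1 := dim_le_of_hom (faceOf x.tail)
    change (cellDim (ε' 0)).dim + (brickDim (Fin.tail ε')).dim =
      (cellDim (ε 0)).dim + (brickDim (Fin.tail ε)).dim at h
    funext i
    refine Fin.cases ?_
      (fun j => congrFun (type_eq_of_dim_eq x.tail (by omega)) j) i
    have h2 : (cellDim (ε' 0)).dim = (cellDim (ε 0)).dim := by omega
    revert h2
    generalize ε' 0 = a, ε 0 = b
    revert a b
    decide

theorem type_eq_false {n : ℕ} (ε : Fin n → Bool) (h : (brickDim ε).dim = n) :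
    ε = fun _ => false :=
  (type_eq_of_dim_eq (topWord ε) ((dim_brickDim_false n).trans h.symm)).symm

theorem BrickWord.eq_id {n : ℕ} {ε : Fin n → Bool} (x : BrickWord ε ε) :
    x = BrickWord.id ε := by
  funext i
  have h : ∀ {b : Bool} (u v : Letter b b), u = v := by
    rintro _ (_ | _) (_ | _) <;> rfl
  exact h _ _

/-- The digits `0` and `1` of the type of a cube of a closed brick mark its components of dimension
one and zero. -/
def cubeType : ∀ {n : ℕ} {ε : Fin n → Bool} {k : Box}, (closedBrick ε).obj k → Fin n → Bool
  | 0, _, _, _ => Fin.elim0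
  | n + 1, ε, k, z =>
    let z : TensorCube (V (ε 0)) (closedBrick (Fin.tail ε)) k := z
    Fin.cons (α := fun _ : Fin (n + 1) => Bool) (z.i.dim == 0) (cubeType z.right)

theorem cubeType_closedIncl : ∀ {n : ℕ} {ε' ε : Fin n → Bool} (x : BrickWord ε' ε),
    cubeType ((closedIncl x).app _ (center ε')) = ε'
  | 0, _, _, _ => funext fun i => i.elim0
  | n + 1, ε', ε, x => by
    funext i
    refine Fin.cases ?_ (fun j => congrFun (cubeType_closedIncl x.tail) j) i
    change ((cellDim (ε' 0)).dim == 0) = ε' 0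
    generalize ε' 0 = b
    cases b <;> rfl

theorem word_eq_nil {m : Box} (g : m ⟶ ⟨0⟩) : Box.word g = [] :=
  List.length_eq_zero_iff.1 (Box.length_word g)

theorem word_eq_zero (g : (⟨1⟩ : Box) ⟶ ⟨1⟩) : Box.word g = [0] := by
  have h1 := Box.length_word g
  have h2 := Box.count_word g
  obtain ⟨a, ha⟩ := List.length_eq_one_iff.1 h1
  rw [ha] at h2 ⊢
  clear ha
  revert h2
  revert a
  decide

/-- Every cube of `V_b` with a face in the image of the minimal cube of `V_a` comes from a letter. -/
theorem Letter.exists_of_rel {a b : Bool} (y : Letter a b) {k : Box} (z : (V b).obj k)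
    (g : cellDim a ⟶ k) (h : (V b).rel g z (y.hom.app _ (cell a))) :
    ∃ (c : Bool) (x : Letter c a) (h : cellDim c = k),
      h ▸ y.hom.app _ (x.hom.app _ (cell c)) = z ∧ Box.word g = x.sign := by
  cases y
  · obtain v | e := z
    · exact h.elim
    · exact ⟨false, .zero, rfl, congrArg GraphCube.edge (Eq.symm h), word_eq_zero g⟩
  · obtain v | e := z
    · exact ⟨true, .one, rfl, congrArg GraphCube.vertex (Eq.symm h), word_eq_nil g⟩
    -- An edge starting at the centre of `V₁` is the second edge; an edge ending there is the first
    -- one.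
    · obtain ⟨h, he⟩ | ⟨h, he⟩ := h
      · exact ⟨false, .plus, rfl, congrArg GraphCube.edge (Fin.castSucc_injective _ he).symm, h⟩
      · exact ⟨false, .minus, rfl, congrArg GraphCube.edge (Fin.succ_injective _ he).symm, h⟩
  · obtain v | e := z
    · exact h.elim
    · exact ⟨false, .zero, rfl, congrArg GraphCube.edge (Eq.symm h), word_eq_zero g⟩
  · obtain v | e := z
    · exact h.elim
    · exact ⟨false, .zero, rfl, congrArg GraphCube.edge (Eq.symm h), word_eq_zero g⟩

/-- Relations in a tensor product split into components, so this is the case of a single letter,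
applied in each coordinate. The form relative to `y` is what makes `brickUnit` preserve relations
between arbitrary cubes. -/
theorem exists_closedIncl_of_rel : ∀ {n : ℕ} {ε' ε : Fin n → Bool} (y : BrickWord ε' ε) {k : Box}
    (z : (closedBrick ε).obj k) (g : brickDim ε' ⟶ k),
    (closedBrick ε).rel g z ((closedIncl y).app _ (center ε')) →
    ∃ (ε'' : Fin n → Bool) (x : BrickWord ε'' ε') (h : brickDim ε'' = k),
      h ▸ (closedIncl y).app _ ((closedIncl x).app _ (center ε'')) = z ∧
        Box.word g = signWord x
  | 0, ε', ε, y, k, z, g, h => by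
    refine ⟨ε', BrickWord.id ε', ?_⟩
    obtain v | e := z
    · exact ⟨rfl, rfl, List.length_eq_zero_iff.1 (Box.length_word g)⟩
    · exact e.elim
  | n + 1, ε', ε, y, ⟨k⟩, ⟨i, j, p, q, hk⟩, g, ⟨u, v, hg, hu, hv⟩ => by
    obtain ⟨c, x0, rfl, rfl, h0⟩ := Letter.exists_of_rel (y 0) p u hu
    obtain ⟨ε'', x1, rfl, rfl, h1⟩ := exists_closedIncl_of_rel y.tail q v hv
    dsimp only at hk
    subst hk
    refine ⟨Fin.cons c ε'', fun i => Fin.cases (motive := fun i =>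
      Letter ((Fin.cons c ε'' : Fin (n + 1) → Bool) i) (ε' i)) x0 x1 i, rfl, rfl, ?_⟩
    exact hg.trans (congrArg₂ (· ++ ·) h0 h1)

/-- The value of a cube `f : B_ε ⟶ P` of the blowup at the minimal cube of `B_ε`. -/
def BlowupCube.value {n : ℕ} {P : RelPrecubicalSet.{w}} {k : Box} (b : BlowupCube n P k) :
    P.obj k :=
  b.dim_eq ▸ b.hom.app (brickDim b.type) (minCube b.type)

/-- The image of a cube of the blowup under a morphism. -/
def BlowupCube.map {n : ℕ} {P : RelPrecubicalSet.{w}} {Q : RelPrecubicalSet.{w'}} {k : Box}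
    (b : BlowupCube n P k) (α : Hom P Q) : BlowupCube n Q k :=
  ⟨b.type, Hom.comp b.hom α, b.dim_eq⟩

/-- In `↑c(ε)` the second components of the two cubes force `g'` to be `faceOf x`, so the relation
in the brick reduces to an equality of words. -/
theorem blowupObj_rel_iff {n : ℕ} {P : RelPrecubicalSet.{w}} {k l : Box} (g : l ⟶ k)
    (a : BlowupCube n P k) (b : BlowupCube n P l) :
    (blowupObj n P).rel g a b ↔ ∃ x : BrickWord a.type b.type,
      Box.word g = signWord x ∧ a.hom = Hom.comp (incl x) b.hom := by
  constructor
  · rintro ⟨x, g', hg, hx, h⟩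
    refine ⟨x, ?_, h⟩
    have h2 : faceOf x ≫ 𝟙 _ = 𝟙 _ ≫ g' := hx.2
    rw [Category.comp_id, Category.id_comp] at h2
    rw [← hg, ← h2, word_faceOf]
  · rintro ⟨x, hg, h⟩
    refine ⟨x, faceOf x, hg.symm, ⟨rel_closedIncl x, ?_⟩, h⟩
    change faceOf x ≫ 𝟙 _ = 𝟙 _ ≫ faceOf x
    rw [Category.comp_id, Category.id_comp]

theorem BlowupCube.value_rel {n : ℕ} {P : RelPrecubicalSet.{w}} {k l : Box} {g : l ⟶ k}
    {a : BlowupCube n P k} {b : BlowupCube n P l} (h : (blowupObj n P).rel g a b) :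
    P.rel g a.value b.value :=
  (blowupMap n P).map_rel h

theorem BlowupCube.value_map {n : ℕ} {P : RelPrecubicalSet.{w}} {Q : RelPrecubicalSet.{w'}}
    {k : Box} (b : BlowupCube n P k) (α : Hom P Q) : (b.map α).value = α.app k b.value := by
  obtain ⟨ε, f, rfl⟩ := b
  rfl

/-- Functoriality of the blowup, for relational precubical sets in different universes. -/
def blowupObjMap (n : ℕ) {P : RelPrecubicalSet.{w}} {Q : RelPrecubicalSet.{w'}} (α : Hom P Q) :
    Hom (blowupObj n P) (blowupObj n Q) where
  app _ b := BlowupCube.map b α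
  map_rel {l k g a b} h := by
    obtain ⟨x, hx, hab⟩ := (blowupObj_rel_iff _ _ _).1 h
    exact (blowupObj_rel_iff _ _ _).2 ⟨x, hx, congrArg (Hom.comp · α) hab⟩

/-- The cube of the blowup of `B_ε` given by a word of `D_ε`. -/
def wordCube {n : ℕ} {ε' ε : Fin n → Bool} (x : BrickWord ε' ε) {k : Box} (h : brickDim ε' = k) :
    BlowupCube n (brick ε) k :=
  ⟨ε', incl x, h⟩

theorem exists_wordCube_of_rel {n : ℕ} {ε' ε : Fin n → Bool} (y : BrickWord ε' ε) {k l : Box}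
    (hl : brickDim ε' = l) (a : (brick ε).obj k) (g : l ⟶ k)
    (h : (brick ε).rel g a (wordCube y hl).value) :
    ∃ (ε'' : Fin n → Bool) (x : BrickWord ε'' ε') (h : brickDim ε'' = k),
      (wordCube (x.comp y) h).value = a ∧ Box.word g = signWord x := by
  subst hl
  obtain ⟨⟨z, f⟩, hz⟩ := a
  obtain ⟨h1, h2⟩ := h
  obtain ⟨ε'', x, rfl, rfl, hg⟩ := exists_closedIncl_of_rel y z g h1
  refine ⟨ε'', x, rfl, ?_, hg⟩
  apply Subtype.ext
  apply Prod.ext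
  · exact congrArg (fun α => Hom.app α _ (center ε'')) (closedIncl_comp x y)
  · obtain rfl : g = faceOf x := Box.hom_ext hg
    have h2' : f = (faceOf y ≫ 𝟙 _) ≫ faceOf x := h2
    change faceOf (x.comp y) ≫ 𝟙 _ = f
    rw [h2', Category.comp_id, Category.comp_id]
    exact Box.hom_ext (signWord_comp x y)

theorem minCube_rel {n : ℕ} {ε : Fin n → Bool} {k : Box} (a : (brick ε).obj k) :
    (brick ε).rel a.1.2 a (minCube ε) :=
  ⟨a.2, (Category.id_comp _).symm⟩

theorem value_wordCube_id {n : ℕ} (ε : Fin n → Bool) :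
    (wordCube (BrickWord.id ε) rfl).value = minCube ε :=
  congrArg (fun α => Hom.app α _ (minCube ε)) (incl_id ε)

theorem exists_wordCube {n : ℕ} {ε : Fin n → Bool} {k : Box} (a : (brick ε).obj k) :
    ∃ (ε' : Fin n → Bool) (x : BrickWord ε' ε) (h : brickDim ε' = k),
      (wordCube x h).value = a := by
  obtain ⟨ε', x, h, rfl, -⟩ := exists_wordCube_of_rel (BrickWord.id ε) rfl a a.1.2
    (by rw [value_wordCube_id]; exact minCube_rel a)
  exact ⟨ε', _, h, rfl⟩

theorem word_wordCube {n : ℕ} {ε' ε : Fin n → Bool} (x : BrickWord ε' ε) {k : Box}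
    (h : brickDim ε' = k) : Box.word (wordCube x h).value.1.2 = signWord x := by
  subst h
  change Box.word (faceOf x ≫ 𝟙 _) = _
  rw [Category.comp_id, word_faceOf]

theorem cubeType_wordCube {n : ℕ} {ε' ε : Fin n → Bool} (x : BrickWord ε' ε) {k : Box}
    (h : brickDim ε' = k) : cubeType (wordCube x h).value.1.1 = ε' := by
  subst h
  exact cubeType_closedIncl x

theorem wordCube_eq {n : ℕ} {ε' ε'' ε : Fin n → Bool} (x : BrickWord ε' ε) (y : BrickWord ε'' ε)
    {k : Box} (hx : brickDim ε' = k) (hy : brickDim ε'' = k) (h : ε' = ε'')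
    (hw : signWord x = signWord y) : wordCube x hx = wordCube y hy := by
  subst h
  rw [BrickWord.eq_of_signWord_eq x y hw]

/-- The first component of the cube shows the type `p(x)`, the second one the sign word; together
they determine `x`. -/
theorem wordCube_injective {n : ℕ} {ε' ε'' ε : Fin n → Bool} (x : BrickWord ε' ε)
    (y : BrickWord ε'' ε) {k : Box} (hx : brickDim ε' = k) (hy : brickDim ε'' = k)
    (h : (wordCube x hx).value = (wordCube y hy).value) : wordCube x hx = wordCube y hy := by
  apply wordCube_eq
  · rw [← cubeType_wordCube x hx, h, cubeType_wordCube]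
  · rw [← word_wordCube x hx, h, word_wordCube]

/-! ### The blowup is euclidean -/

theorem exists_brickCube {n : ℕ} {ε : Fin n → Bool} {k : Box} (a : (brick ε).obj k) :
    ∃ b : BlowupCube n (brick ε) k, ∃ (ε' : Fin n → Bool) (x : BrickWord ε' ε)
      (h : brickDim ε' = k), wordCube x h = b ∧ b.value = a := by
  obtain ⟨ε', x, h, rfl⟩ := exists_wordCube a
  exact ⟨_, ε', x, h, rfl, rfl⟩

/-- The cube `ι_x` of the blowup of `B_ε` for the cube `ι_x(min(B_{p(x)}))` of `B_ε`. -/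
noncomputable def brickCube {n : ℕ} {ε : Fin n → Bool} {k : Box} (a : (brick ε).obj k) :
    BlowupCube n (brick ε) k :=
  (exists_brickCube a).choose

/-- Uniqueness of the word makes the choice in `brickCube` harmless. -/
theorem brickCube_wordCube {n : ℕ} {ε' ε : Fin n → Bool} (x : BrickWord ε' ε) {k : Box}
    (h : brickDim ε' = k) : brickCube (wordCube x h).value = wordCube x h := by
  obtain ⟨ε'', y, h', hy, hv⟩ := (exists_brickCube (wordCube x h).value).choose_spec
  change wordCube y h' = brickCube _ at hy
  change (brickCube _).value = _ at hv
  rw [← hy] at hv ⊢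
  exact wordCube_injective _ _ _ _ hv

/-- The morphism from `B_ε` to its blowup. -/
noncomputable def brickUnit {n : ℕ} (ε : Fin n → Bool) :
    Hom (brick ε) (blowupObj n (brick ε)) where
  app _ a := brickCube a
  map_rel {l k g a b} h := by
    obtain ⟨ε', y, rfl, rfl⟩ := exists_wordCube b
    obtain ⟨ε'', x, rfl, rfl, hg⟩ := exists_wordCube_of_rel y rfl a g h
    rw [brickCube_wordCube, brickCube_wordCube, blowupObj_rel_iff]
    exact ⟨x, hg, incl_comp x y⟩

/-- The chart at a cube of the blowup. -/
noncomputable def blowupChart {n : ℕ} {P : RelPrecubicalSet.{w}} {ε : Fin n → Bool}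
    (f : Hom (brick ε) P) :
    Hom (brick ε) ((blowupObj n P).up (c := brickDim ε) (⟨ε, f, rfl⟩ : BlowupCube n P _)) where
  app _ a := ⟨(BlowupCube.map (brickCube a) f, a.1.2), by
    obtain ⟨ε', x, rfl, rfl⟩ := exists_wordCube a
    rw [blowupObj_rel_iff, brickCube_wordCube]
    exact ⟨x, word_wordCube x rfl, rfl⟩⟩
  map_rel h := ⟨(blowupObjMap n f).map_rel ((brickUnit ε).map_rel h), h.2⟩

theorem isEuclidean_blowupObj (n : ℕ) (P : RelPrecubicalSet.{w}) :
    isEuclidean n (blowupObj n P) := by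
  rintro _ ⟨ε, f, rfl⟩
  refine ⟨ε, blowupChart f, ?_, ?_⟩
  -- Surjectivity: the word witnessing the relation names the preimage.
  · rintro k ⟨⟨b, g⟩, h⟩
    obtain ⟨x, hg, hb⟩ := (blowupObj_rel_iff _ _ _).1 h
    refine ⟨(wordCube x b.dim_eq).value, Subtype.ext (Prod.ext ?_ ?_)⟩
    · change (brickCube _).map f = b
      rw [brickCube_wordCube]
      obtain ⟨ε', b, rfl⟩ := b
      exact congrArg (BlowupCube.mk ε' · rfl) hb.symm
    · exact Box.hom_ext ((word_wordCube x b.dim_eq).trans hg.symm)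
  -- Equal images have equal types and equal sign words, so the chart is injective outright.
  · intro k m g a b c _ _ hne heq
    apply hne
    obtain ⟨ε', x, rfl, rfl⟩ := exists_wordCube a
    obtain ⟨ε'', y, hy, rfl⟩ := exists_wordCube b
    have h1 : (brickCube (wordCube x rfl).value).map f = (brickCube (wordCube y hy).value).map f :=
      congrArg (fun p => p.1.1) heq
    have h2 : (wordCube x rfl).value.1.2 = (wordCube y hy).value.1.2 :=
      congrArg (fun p => p.1.2) heq
    rw [brickCube_wordCube, brickCube_wordCube] at h1
    refine congrArg BlowupCube.value (wordCube_eq x y rfl hy (congrArg BlowupCube.type h1) ?_)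
    rw [← word_wordCube x rfl, h2, word_wordCube]

/-! ### The blowup map of a euclidean relational precubical set -/

/-- A cube `b` of the blowup lifts relations if every cube with the value of `b` as a face is the
value of a cube with `b` as a face. -/
def BlowupCube.LiftsRel {n : ℕ} {P : RelPrecubicalSet.{w}} {k : Box} (b : BlowupCube n P k) :
    Prop :=
  ∀ {l : Box} (g : k ⟶ l) (d : P.obj l), P.rel g d b.value →
    ∃ b' : BlowupCube n P l, (blowupObj n P).rel g b' b ∧ b'.value = d

/-- A surjective morphism from a euclidean brick to `↑c` maps the minimal cube to the minimal
cube. -/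
theorem exists_app_minCube_eq {n : ℕ} {P : RelPrecubicalSet.{w}} {k : Box} {c : P.obj k}
    {ε : Fin n → Bool} (φ : Hom (brick ε) (P.up c)) (hφ : φ.IsSurjective) :
    ∃ h : brickDim ε = k, h ▸ (φ.app _ (minCube ε)).1.1 = c ∧
      Box.word (φ.app _ (minCube ε)).1.2 = Box.word (𝟙 k) := by
  obtain ⟨a, ha⟩ := hφ k ⟨(c, 𝟙 k), P.refl c⟩
  obtain ⟨ε', x, rfl, rfl⟩ := exists_wordCube a
  -- The image of the minimal cube lies above `c`, and the minimal cube is a face of the preimage of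
  -- `(c, 𝟙)`. So the dimensions agree and `x` is the identity word.
  obtain rfl : ε' = ε := type_eq_of_dim_eq x <|
    (dim_le_of_hom (φ.app _ (minCube ε)).1.2).antisymm (dim_le_of_hom (faceOf x))
  have hx : (wordCube x rfl).value = minCube ε' := by
    rw [x.eq_id, value_wordCube_id]
  rw [hx] at ha
  rw [ha]
  exact ⟨rfl, rfl, rfl⟩

theorem isEuclidean.exists_liftsRel {n : ℕ} {P : RelPrecubicalSet.{w}} (hP : isEuclidean n P)
    {k : Box} (c : P.obj k) : ∃ b : BlowupCube n P k, b.value = c ∧ b.LiftsRel := by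
  obtain ⟨ε, φ, hφ, -⟩ := hP k c
  obtain ⟨rfl, hc, hw⟩ := exists_app_minCube_eq φ hφ
  have hw : (φ.app _ (minCube ε)).1.2 = 𝟙 _ := Box.hom_ext hw
  let ψ : Hom (brick ε) P :=
    { app := fun l a => (φ.app l a).1.1
      map_rel := fun h => (φ.map_rel h).1 }
  refine ⟨⟨ε, ψ, rfl⟩, hc, ?_⟩
  intro l g d hd
  have hd : P.rel g d (φ.app _ (minCube ε)).1.1 := hd
  dsimp only at hc
  rw [hc] at hd
  obtain ⟨a, ha⟩ := hφ l ⟨(d, g), hd⟩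
  obtain ⟨ε', x, rfl, rfl⟩ := exists_wordCube a
  refine ⟨⟨ε', Hom.comp (incl x) ψ, rfl⟩, (blowupObj_rel_iff _ _ _).2 ⟨x, ?_, rfl⟩,
    congrArg (fun p => p.1.1) ha⟩
  -- Since the chart sends the minimal cube to a pair with second component the identity, it
  -- preserves second components; hence `g` is the sign word of `x`.
  have h1 : (φ.app _ (wordCube x rfl).value).1.2 =
      (φ.app _ (minCube ε)).1.2 ≫ (wordCube x rfl).value.1.2 :=
    (φ.map_rel (minCube_rel (wordCube x rfl).value)).2
  rw [ha, hw, Category.id_comp] at h1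
  have h2 : g = (wordCube x rfl).value.1.2 := h1
  rw [h2, word_wordCube]

/-- A top-dimensional restriction of `b'` has a value above the common value, so it lifts to a cube
above `b` with the same sign word. Top-dimensional sign words determine the type. -/
theorem BlowupCube.LiftsRel.type_eq {n : ℕ} {P : RelPrecubicalSet.{w}} {k : Box}
    {b b' : BlowupCube n P k} (hb : b.LiftsRel) (h : b.value = b'.value) : b.type = b'.type := by
  obtain ⟨ε, f, rfl⟩ := b'
  let t : BlowupCube n P (brickDim fun _ : Fin n => false) :=
    ⟨_, Hom.comp (incl (topWord ε)) f, rfl⟩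
  have ht : (blowupObj n P).rel (faceOf (topWord ε)) t (⟨ε, f, rfl⟩ : BlowupCube n P _) :=
    (blowupObj_rel_iff _ _ _).2 ⟨topWord ε, rfl, rfl⟩
  obtain ⟨s, hs, -⟩ := hb (faceOf (topWord ε)) t.value (h ▸ BlowupCube.value_rel ht)
  obtain ⟨x, hx, -⟩ := (blowupObj_rel_iff _ _ _).1 hs
  obtain ⟨δ, s, hδ⟩ := s
  obtain rfl := type_eq_false δ (hδ ▸ dim_brickDim_false n)
  exact type_eq_of_signWord_eq x (topWord ε) hx.symm

theorem isEuclidean.value_injective {n : ℕ} {P : RelPrecubicalSet.{w}} (hP : isEuclidean n P)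
    {k : Box} {b b' : BlowupCube n P k} (h : b.value = b'.value) : b = b' := by
  -- Both cubes can be compared with a lifting cube of the same value.
  wlog hb : b.LiftsRel generalizing b b'
  · obtain ⟨b₀, h₀, hb₀⟩ := hP.exists_liftsRel b.value
    exact (this h₀ hb₀).symm.trans (this (h₀.trans h) hb₀)
  have ht := hb.type_eq h
  obtain ⟨ε, f, rfl⟩ := b
  obtain ⟨ε', f', hk⟩ := b'
  dsimp only at ht
  subst ht
  suffices f = f' by rw [this]
  apply Hom.ext
  funext l a
  obtain ⟨δ, x, rfl, rfl⟩ := exists_wordCube a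
  let d : BlowupCube n P (brickDim δ) := ⟨δ, Hom.comp (incl x) f', rfl⟩
  have hd : (blowupObj n P).rel (faceOf x) d (⟨ε, f', rfl⟩ : BlowupCube n P _) :=
    (blowupObj_rel_iff _ _ _).2 ⟨x, rfl, rfl⟩
  obtain ⟨e, he, hed⟩ := hb (faceOf x) d.value (h ▸ BlowupCube.value_rel hd)
  obtain ⟨y, hy, hye⟩ := (blowupObj_rel_iff _ _ _).1 he
  -- Neither `d` nor `e` is known to lift relations, so their types are compared through a third
  -- cube that does.
  obtain ⟨c, hc, hcl⟩ := hP.exists_liftsRel d.value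
  have hδ : e.type = δ := (hcl.type_eq (hc.trans hed.symm)).symm.trans (hcl.type_eq hc)
  obtain ⟨δ', e, he'⟩ := e
  dsimp only at hδ
  subst hδ
  obtain rfl := BrickWord.eq_of_signWord_eq x y hy
  dsimp only at hye
  subst hye
  exact hed

/-- The inverse of the blowup map of a euclidean relational precubical set. -/
noncomputable def euclideanUnit {n : ℕ} {P : RelPrecubicalSet.{w}} (hP : isEuclidean n P) :
    Hom P (blowupObj n P) where
  app _ c := (hP.exists_liftsRel c).choose
  map_rel {l k g a b} h := by
    have ha := (hP.exists_liftsRel a).choose_spec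
    have hb := (hP.exists_liftsRel b).choose_spec
    -- The lift of `a` above the cube chosen for `b` is the cube chosen for `a`, by injectivity of
    -- values.
    obtain ⟨a', ha', rfl⟩ := hb.2 g a (hb.1.symm ▸ h)
    rwa [hP.value_injective ha.1]

theorem value_euclideanUnit {n : ℕ} {P : RelPrecubicalSet.{w}} (hP : isEuclidean n P) {k : Box}
    (c : P.obj k) : BlowupCube.value ((euclideanUnit hP).app k c) = c :=
  (hP.exists_liftsRel c).choose_spec.1

theorem euclideanUnit_eq_of_value_eq {n : ℕ} {P : RelPrecubicalSet.{w}} (hP : isEuclidean n P)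
    {k : Box} {c : P.obj k} {b : BlowupCube n P k} (h : b.value = c) :
    (euclideanUnit hP).app k c = b :=
  hP.value_injective ((value_euclideanUnit hP c).trans h.symm)

/-- The witness sends `ι_x(min)` to `f ∘ ι_x`: at the minimal cube this is `f`, and taking values
turns it back into `f`. By injectivity of values it is the image of `b` under the unit, which gives
the second triangle identity. -/
theorem exists_value_eq_self {n : ℕ} {P : RelPrecubicalSet.{w}} {k : Box}
    (b : BlowupCube n P k) :
    ∃ b' : BlowupCube n (blowupObj n P) k, b'.value = b ∧ b'.map (blowupMap n P) = b := by
  obtain ⟨ε, f, rfl⟩ := b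
  refine ⟨⟨ε, Hom.comp (brickUnit ε) (blowupObjMap n f), rfl⟩, ?_, ?_⟩
  · change BlowupCube.map (brickCube (minCube ε)) f = _
    rw [← value_wordCube_id, brickCube_wordCube]
    exact congrArg (fun α => BlowupCube.mk ε (Hom.comp α f) rfl) (incl_id ε)
  · refine congrArg (BlowupCube.mk ε · rfl) (Hom.ext ?_)
    funext l a
    change BlowupCube.value (BlowupCube.map (brickCube a) f) = f.app l a
    obtain ⟨ε', x, h, rfl⟩ := exists_wordCube a
    rw [brickCube_wordCube, BlowupCube.value_map]

/-! ### The adjunction -/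

/-- The blowup is right adjoint to the inclusion of euclidean relational precubical sets. -/
noncomputable def blowupAdjunction (n : ℕ) :
    (isEuclidean.{w} n).ι ⊣
      (isEuclidean.{w} n).lift (blowup.{w} n) (isEuclidean_blowupObj n) :=
  Adjunction.mkOfUnitCounit
    { unit :=
        { app := fun P => ObjectProperty.homMk (euclideanUnit P.property)
          naturality := fun P Q α => by
            apply ObjectProperty.hom_ext
            refine Hom.ext (funext fun k => funext fun c => ?_)
            refine euclideanUnit_eq_of_value_eq Q.property
              (b := BlowupCube.map ((euclideanUnit P.property).app k c) α.hom) ?_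
            exact (BlowupCube.value_map _ α.hom).trans
              (congrArg (α.hom.app k) (value_euclideanUnit P.property c)) }
      counit :=
        { app := fun P => blowupMap n P
          naturality := fun P Q α =>
            Hom.ext (funext fun k => funext fun b => BlowupCube.value_map b α) }
      left_triangle := by
        ext P
        refine Hom.ext (funext fun k => funext fun c => ?_)
        exact value_euclideanUnit P.property c
      right_triangle := by
        ext P
        refine Hom.ext (funext fun k => funext fun b => ?_)
        obtain ⟨b', h, hb⟩ := exists_value_eq_self (n := n) (P := P) b
        have h' := euclideanUnit_eq_of_value_eq (isEuclidean_blowupObj n P) h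
        exact (congrArg (fun z => BlowupCube.map z (blowupMap n P)) h').trans hb }

end RelPrecubicalSet

theorem mainTheorem2 (n : ℕ) :
    Nonempty (Coreflective (RelPrecubicalSet.isEuclidean.{w} n).ι) ∧
    ∃ (h : ∀ P : RelPrecubicalSet.{w},
        RelPrecubicalSet.isEuclidean.{w} n ((RelPrecubicalSet.blowup.{w} n).obj P))
      (adj : (RelPrecubicalSet.isEuclidean.{w} n).ι ⊣
        (RelPrecubicalSet.isEuclidean.{w} n).lift (RelPrecubicalSet.blowup.{w} n) h),
      ∀ P : RelPrecubicalSet.{w}, adj.counit.app P = RelPrecubicalSet.blowupMap n P :=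
  ⟨⟨{ R := _, adj := RelPrecubicalSet.blowupAdjunction n }⟩,
    RelPrecubicalSet.isEuclidean_blowupObj n, RelPrecubicalSet.blowupAdjunction n,
    fun _ => rfl⟩
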